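/- Let $\mathbb{X}$ and $\mathbb{E}$ be finite-dimensional Euclidean spaces, $\Phi:\mathbb{X}\to\mathbb{E}$ a linear operator, and $g:\mathbb{X}\to\mathbb{R}\cup\{\infty\}$ a proper lower semicontinuous convex function. For $b\in\mathbb{E}$ and $\mu>0$ consider the problem $$P(b,\mu):\quad \min_{x\in\mathbb{X}}\ \frac{1}{2\mu}\|\Phi x-b\|^2+g(x),$$ and let $S_{LS}(b,\mu)\subset\mathbb{X}$ be its set of optimal solutions. Let $\bar b\in\mathbb{E}$, $\bar\mu>0$, let $\bar x\in S_{LS}(\bar b,\bar\mu)$, and put $\bar y:=-\frac{1}{\bar\mu}\Phi^*(\Phi\bar x-\bar b)$. Let $\partial g(x)=\{v\mid g(u)-g(x)\ge\langle v,u-x\rangle\ \ \forall u\in\mathbb{X}\}$ denote the subdifferential of $g$, and $g^*(v)=\sup_{x\in\mathbb{X}}\{\langle v,x\rangle-g(x)\}$ its Fenchel conjugate. Suppose that $g$ satisfies the quadratic growth condition at $\bar x$ for $\bar y$: there are $c,\varepsilon>0$ with $$g(x)\ge g(\bar x)+\langle\bar y,x-\bar x\rangle+\frac c2\, d\big(x;(\partial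 g)^{-1}(\bar y)\big)^2\quad\text{whenever }\|x-\bar x\|<\varepsilon .$$ Then the following are equivalent: (i) $S_{LS}$ is isolated calm at $(\bar b,\bar\mu)$ for $\bar x$: there are $\kappa>0$ and neighborhoods $U$ of $\bar x$ in $\mathbb{X}$, $V$ of $\bar b$ in $\mathbb{E}$ and $W$ of $\bar\mu$ in $(0,\infty)$ such that $\|x-\bar x\|\le\kappa(\|b-\bar b\|+|\mu-\bar\mu|)$ for all $(b,\mu)\in V\times W$ and all $x\in S_{LS}(b,\mu)\cap U$. (ii) $\bar x$ is a strong solution (of order $2$) of $P(\bar b,\bar\mu)$: there are $c,\varepsilon>0$ with $\psi(x)\ge\psi(\bar x)+\frac c2\|x-\bar x\|^2$ whenever $\|x-\bar x\|<\varepsilon$, where $\psi(x)=\frac{1}{2\bar\mu}\|\Phi x-\bar b\|^2+g(x)$. (iii) $\operatorname{Ker}\Phi\cap T_{\partial g^*(\bar y)}(\bar x)=\{0\}$, where $T_\Omega(\bar x)$ is the set of all $w\in\mathbb{X}$ for which there are $t_k>0$ with $t_k\to0$ and $w_k\to w$ such that $\bar x+t_kw_k\in\Omega$ for all $k$. -/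

import Mathlib

open Set Filter Topology

namespace IsolatedCalmness

noncomputable section

section Convex

variable {X : Type*} [NormedAddCommGroup X] [InnerProductSpace ℝ X]

/-- `φ : X → ℝ ∪ {+∞}` is proper, lower semicontinuous and convex (i.e. its epigraph is convex). -/
structure IsProperLscConvex (φ : X → EReal) : Prop where
  ne_bot : ∀ x, φ x ≠ ⊥
  exists_ne_top : ∃ x, φ x ≠ ⊤
  lsc : LowerSemicontinuous φ
  convex_epigraph : Convex ℝ {p : X × ℝ | φ p.1 ≤ (p.2 : EReal)}

/-- The subdifferential `∂φ(x) = {v | φ u - φ x ≥ ⟪v, u - x⟫ for all u}`.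
For proper `φ` it is empty at points where `φ x = ⊤`. -/
def subdifferential (φ : X → EReal) (x : X) : Set X :=
  {v | ∀ u : X, φ x + ((inner ℝ v (u - x) : ℝ) : EReal) ≤ φ u}

/-- The Fenchel conjugate `φ*(v) = sup_x (⟪v, x⟫ - φ x)`. -/
def conjugate (φ : X → EReal) (v : X) : EReal :=
  ⨆ x : X, (((inner ℝ v x : ℝ) : EReal) - φ x)

/-- The Bouligand (contingent) tangent cone to `Ω` at `x`: all limits `w` of sequences `w_k` with
`x + t_k w_k ∈ Ω` for some positive `t_k → 0`. -/
def tangentCone (Ω : Set X) (x : X) : Set X :=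
  {w | ∃ (t : ℕ → ℝ) (z : ℕ → X), (∀ k, 0 < t k) ∧ Tendsto t atTop (𝓝 0) ∧
    Tendsto z atTop (𝓝 w) ∧ ∀ k, x + t k • z k ∈ Ω}

/-- The quadratic growth condition of `φ` at `x₀` for `v₀`, where `x₀ ∈ dom φ` and
`v₀ ∈ ∂φ(x₀)` are understood. The distance is taken to the set `(∂φ)⁻¹(v₀)`, which then
contains `x₀` (so it is non-empty, and `Metric.infDist` is the usual distance). -/
def QuadraticGrowth (φ : X → EReal) (x₀ v₀ : X) : Prop :=
  ∃ c > (0 : ℝ), ∃ ε > (0 : ℝ), ∀ x ∈ Metric.ball x₀ ε,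
    φ x₀ + ((inner ℝ v₀ (x - x₀) +
      c / 2 * Metric.infDist x {u | v₀ ∈ subdifferential φ u} ^ 2 : ℝ) : EReal) ≤ φ x

/-- `x₀` is a strong solution (of order two) of the problem of minimizing `φ`. -/
def IsStrongSolution (φ : X → EReal) (x₀ : X) : Prop :=
  φ x₀ ≠ ⊤ ∧ ∃ c > (0 : ℝ), ∃ ε > (0 : ℝ), ∀ x ∈ Metric.ball x₀ ε,
    φ x₀ + ((c / 2 * ‖x - x₀‖ ^ 2 : ℝ) : EReal) ≤ φ x

/-- The set of global minimizers of `φ`. -/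
def argmin (φ : X → EReal) : Set X :=
  {x | ∀ u : X, φ x ≤ φ u}

end Convex

section LeastSquares

variable {X Y E : Type*} [NormedAddCommGroup X] [InnerProductSpace ℝ X]
  [NormedAddCommGroup Y] [InnerProductSpace ℝ Y]
  [NormedAddCommGroup E] [InnerProductSpace ℝ E]

/-- The objective `x ↦ ‖Φ x - b‖² / (2 μ) + g (K x)` of the problem `P(b, μ)`. -/
def objective (Φ : X →ₗ[ℝ] E) (K : X →ₗ[ℝ] Y) (g : Y → EReal) (b : E) (μ : ℝ) (x : X) : EReal :=
  ((1 / (2 * μ) * ‖Φ x - b‖ ^ 2 : ℝ) : EReal) + g (K x)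

/-- The optimal solution mapping `S_LS(b, μ)` of the problem `P(b, μ)`. -/
def solutionMap (Φ : X →ₗ[ℝ] E) (K : X →ₗ[ℝ] Y) (g : Y → EReal) (b : E) (μ : ℝ) : Set X :=
  argmin (objective Φ K g b μ)

/-- Isolated calmness at `(b₀, μ₀)` for `x₀` of a set-valued mapping `S` of the parameters
`(b, μ)` in `E × (0, ∞)`: `x₀ ∈ S(b₀, μ₀)` and, for some `κ > 0` and some neighborhood
`U × V × W` of `(x₀, b₀, μ₀)` in `X × E × (0, ∞)`, the set `S(b, μ) ∩ U` lies in the closed ball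
around `x₀` of radius `κ (‖b - b₀‖ + |μ - μ₀|)` for all `(b, μ) ∈ V × W`. -/
def IsolatedCalm (S : E → ℝ → Set X) (b₀ : E) (μ₀ : ℝ) (x₀ : X) : Prop :=
  x₀ ∈ S b₀ μ₀ ∧ ∃ κ > (0 : ℝ), ∃ U ∈ 𝓝 x₀, ∃ V ∈ 𝓝 b₀, ∃ W ∈ 𝓝 μ₀, W ⊆ Ioi 0 ∧
    ∀ b ∈ V, ∀ μ ∈ W, S b μ ∩ U ⊆ Metric.closedBall x₀ (κ * (‖b - b₀‖ + |μ - μ₀|))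

end LeastSquares

end

end IsolatedCalmness

/-! Two facts drive the cycle (i) → (iii) → (ii) → (i): `x` solves P(b, μ) iff -(1/μ)Φ*(Φx - b) ∈
∂g(x), and ∂g*(ȳ) = (∂g)⁻¹(ȳ). (i) → (iii): if x̄ + tz ∈ ∂g*(ȳ), then x̄ + tz solves the problem
with data b̄ + tΦz, since the residual is unchanged. Calmness gives ‖z‖ ≤ κ‖Φz‖, so a tangent
direction in Ker Φ vanishes. (iii) → (ii): expanding the square, quadratic growth yields ψ(x) -
ψ(x̄) ≥ ‖Φ(x - x̄)‖²/(2μ̄) + (c/2) d(x; (∂g)⁻¹(ȳ))². If strong growth failed, normalized violating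
directions would accumulate at a unit vector in both Ker Φ and the tangent cone. (ii) → (i): adding
strong growth to the optimality of a perturbed solution cancels g; what remains is linear in Φ(x -
x̄) and in the size of the perturbation. -/

namespace IsolatedCalmness

/-! ### Subdifferentials, conjugates and tangent cones. -/

section Convex

variable {X : Type*} [NormedAddCommGroup X] [InnerProductSpace ℝ X]

theorem IsProperLscConvex.isClosed_epigraph {φ : X → EReal} (hφ : IsProperLscConvex φ) :
    IsClosed {p : X × ℝ | φ p.1 ≤ (p.2 : EReal)} :=
  hφ.lsc.isClosed_epigraph.preimage
    (continuous_fst.prodMk (continuous_coe_real_ereal.comp continuous_snd))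

theorem mem_subdifferential_conjugate {φ : X → EReal} {x y : X} (h : y ∈ subdifferential φ x) :
    x ∈ subdifferential (conjugate φ) y := by
  intro v
  have hy : conjugate φ y ≤ ((inner ℝ y x : ℝ) : EReal) - φ x := by
    refine iSup_le fun u => ?_
    have hu := h u
    rw [inner_sub_right] at hu
    induction hx : φ x <;> induction hu' : φ u <;> simp_all
    all_goals norm_cast at *
    all_goals linarith
  have hv : ((inner ℝ v x : ℝ) : EReal) - φ x ≤ conjugate φ v :=
    le_iSup (fun u => ((inner ℝ v u : ℝ) : EReal) - φ u) x
  refine (add_le_add_left hy _).trans (le_trans (le_of_eq ?_) hv)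
  rw [inner_sub_right, real_inner_comm v x, real_inner_comm y x]
  induction φ x with
  | bot => simp only [EReal.coe_sub_bot, EReal.top_add_coe]
  | top => simp only [EReal.sub_top, EReal.bot_add]
  | coe r =>
    norm_cast
    ring

/-- A special case of the Fenchel–Moreau theorem: `∂φ*` inverts `∂φ` at every `y` in the range
of `∂φ`. -/
theorem mem_subdifferential_of_mem_subdifferential_conjugate [CompleteSpace X] {φ : X → EReal}
    (hφ : IsProperLscConvex φ) {x x₀ y : X} {γ : ℝ} (hγ : φ x₀ = γ)
    (h₀ : y ∈ subdifferential φ x₀) (h : x ∈ subdifferential (conjugate φ) y) :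
    y ∈ subdifferential φ x := by
  -- `ρ` is the value at `x` of the affine minorant of `φ` that is exact at `x₀`; if `φ x` does not
  -- exceed it, the minorant is exact at `x` too.
  set ρ : ℝ := γ + inner ℝ y (x - x₀) with hρ
  suffices hx : φ x ≤ (ρ : EReal) by
    intro u
    refine (add_le_add_left hx _).trans (le_trans (le_of_eq ?_) (h₀ u))
    rw [hγ, hρ]
    norm_cast
    simp only [inner_sub_right]
    ring
  by_contra hx
  obtain ⟨f, α, hf, hfx⟩ := geometric_hahn_banach_closed_point hφ.convex_epigraph
    hφ.isClosed_epigraph (x := (x, ρ)) hx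
  set v : X := (InnerProductSpace.toDual ℝ X).symm (f.comp (ContinuousLinearMap.inl ℝ X ℝ))
  have hfv : ∀ u r, f (u, r) = inner ℝ v u + r * f (0, 1) := by
    intro u r
    have h1 : inner ℝ v u = f (u, 0) := by simp [v]
    have h2 : ((u, r) : X × ℝ) = (u, 0) + r • (0, 1) := by simp
    rw [h1, h2, map_add, map_smul, smul_eq_mul]
  set s := f (0, 1)
  have hs : s ≤ 0 := by
    by_contra! hs
    set r := max γ ((α - inner ℝ v x₀) / s)
    have h1 := hf (x₀, r) (by simp [hγ, r])
    have h2 : (α - inner ℝ v x₀) / s ≤ r := le_max_right _ _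
    rw [hfv] at h1
    rw [div_le_iff₀ hs] at h2
    linarith
  rw [hfv] at hfx
  have hpos : 0 < 1 - s := by linarith
  -- The separating hyperplane may be vertical (`s = 0`). Adding the minorant of slope `y` tilts it,
  -- and `w` is the resulting slope; the bound on `conjugate φ w` then contradicts `h w`.
  set w : X := (1 - s)⁻¹ • (v + y) with hw
  have hinner : ∀ u, (1 - s) * inner ℝ w u = inner ℝ v u + inner ℝ y u := by
    intro u
    rw [hw, real_inner_smul_left, inner_add_left, mul_inv_cancel_left₀ hpos.ne']
  have hwle : conjugate φ w ≤ (((α + inner ℝ y x₀ - γ) / (1 - s) : ℝ) : EReal) := by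
    refine iSup_le fun u => ?_
    have hu := h₀ u
    rw [hγ] at hu
    induction hφu : φ u with
    | bot => exact absurd hφu (hφ.ne_bot u)
    | top => simp
    | coe r =>
      rw [hφu] at hu
      norm_cast at hu ⊢
      have h1 := hf (u, r) (by simp [hφu])
      rw [hfv] at h1
      rw [le_div_iff₀ hpos]
      rw [inner_sub_right] at hu
      linarith [hinner u]
  have hyle : ((inner ℝ y x₀ - γ : ℝ) : EReal) ≤ conjugate φ y := by
    have := le_iSup (fun u => ((inner ℝ y u : ℝ) : EReal) - φ u) x₀
    rw [hγ] at this
    exact_mod_cast this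
  have key := ((add_le_add_left hyle _).trans (h w)).trans hwle
  norm_cast at key
  rw [le_div_iff₀ hpos, inner_sub_right, real_inner_comm w x, real_inner_comm y x] at key
  rw [inner_sub_right] at hρ
  have := hinner x
  rw [hρ] at hfx
  linarith

theorem zero_mem_tangentCone {Ω : Set X} {x : X} (hx : x ∈ Ω) : 0 ∈ tangentCone Ω x :=
  ⟨fun k => 1 / ((k : ℝ) + 1), fun _ => 0, fun _ => Nat.one_div_pos_of_nat,
    tendsto_one_div_add_atTop_nhds_zero_nat, tendsto_const_nhds, fun _ => by simpa using hx⟩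

/-- Directions along which `Ω` is approached to first order are tangent to `Ω`. -/
theorem mem_tangentCone_of_tendsto_infDist {Ω : Set X} {x w : X} (hΩ : Ω.Nonempty) {t : ℕ → ℝ}
    {z : ℕ → X} (ht : ∀ k, 0 < t k) (ht0 : Tendsto t atTop (𝓝 0)) (hz : Tendsto z atTop (𝓝 w))
    (hd : Tendsto (fun k => Metric.infDist (x + t k • z k) Ω / t k) atTop (𝓝 0)) :
    w ∈ tangentCone Ω x := by
  -- A slack of order o(t_k) replaces exact projections, so `Ω` need not be closed.
  have hex : ∀ k : ℕ, ∃ p ∈ Ω, dist (x + t k • z k) p <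
      Metric.infDist (x + t k • z k) Ω + t k * (1 / ((k : ℝ) + 1)) := fun k =>
    (Metric.infDist_lt_iff hΩ).1
      (lt_add_of_pos_right _ (mul_pos (ht k) Nat.one_div_pos_of_nat))
  choose p hp hpd using hex
  refine ⟨t, fun k => (t k)⁻¹ • (p k - x), ht, ht0, ?_, fun k => ?_⟩
  · have hlim := hd.add tendsto_one_div_add_atTop_nhds_zero_nat
    rw [add_zero] at hlim
    have hdiff : Tendsto (fun k => (t k)⁻¹ • (p k - x) - z k) atTop (𝓝 0) := by
      refine squeeze_zero_norm (fun k => ?_) hlim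
      have h1 : (t k)⁻¹ • (p k - x) - z k = (t k)⁻¹ • (p k - (x + t k • z k)) := by
        rw [← sub_sub, smul_sub _ (p k - x), inv_smul_smul₀ (ht k).ne']
      have h2 := (hpd k).le
      rw [dist_comm, dist_eq_norm] at h2
      rw [h1, norm_smul, norm_inv, Real.norm_of_nonneg (ht k).le, inv_mul_le_iff₀ (ht k)]
      rw [mul_add, mul_div_cancel₀ _ (ht k).ne']
      exact h2
    simpa using hdiff.add hz
  · simpa [smul_inv_smul₀ (ht k).ne'] using hp k

end Convex

/-! ### Optimality conditions and the three implications. -/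

section LeastSquares

section Inner

variable {X E : Type*}
  [NormedAddCommGroup X] [InnerProductSpace ℝ X]
  [NormedAddCommGroup E] [InnerProductSpace ℝ E]

theorem sq_norm_sub_sub_sq_norm_sub (p q b : E) :
    ‖p - b‖ ^ 2 - ‖q - b‖ ^ 2 = inner ℝ (p - q) (p + q - (2 : ℝ) • b) := by
  have h1 : p - q = (p - b) - (q - b) := by abel
  have h2 : p + q - (2 : ℝ) • b = (p - b) + (q - b) := by module
  rw [h1, h2, inner_sub_left, inner_add_right, inner_add_right, real_inner_self_eq_norm_sq,
    real_inner_self_eq_norm_sq, real_inner_comm (q - b) (p - b)]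
  ring

theorem exists_eq_coe_of_mem_solutionMap {Φ : X →ₗ[ℝ] E} {g : X → EReal}
    (hg : IsProperLscConvex g) {b : E} {μ : ℝ} {x : X}
    (hx : x ∈ solutionMap Φ LinearMap.id g b μ) : ∃ γ : ℝ, g x = γ := by
  obtain ⟨u, hu⟩ := hg.exists_ne_top
  have h := hx u
  simp only [objective, LinearMap.id_apply] at h
  induction hgx : g x with
  | bot => exact absurd hgx (hg.ne_bot x)
  | coe r => exact ⟨r, rfl⟩
  | top =>
    rw [hgx, EReal.coe_add_top, top_le_iff] at h
    induction hgu : g u with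
    | bot => exact absurd hgu (hg.ne_bot u)
    | top => exact absurd hgu hu
    | coe r =>
      rw [hgu] at h
      exact absurd h (EReal.coe_ne_top _)

end Inner

variable {X E : Type*}
  [NormedAddCommGroup X] [InnerProductSpace ℝ X] [FiniteDimensional ℝ X]
  [NormedAddCommGroup E] [InnerProductSpace ℝ E] [FiniteDimensional ℝ E]

theorem sq_norm_residual (Φ : X →ₗ[ℝ] E) (b : E) (μ : ℝ) (x u : X) :
    1 / (2 * μ) * ‖Φ u - b‖ ^ 2 = 1 / (2 * μ) * ‖Φ x - b‖ ^ 2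
      - inner ℝ (-((1 / μ) • LinearMap.adjoint Φ (Φ x - b))) (u - x)
      + 1 / (2 * μ) * ‖Φ (u - x)‖ ^ 2 := by
  have h : Φ u - b = (Φ x - b) + Φ (u - x) := by rw [map_sub]; abel
  rw [h, norm_add_sq_real, inner_neg_left, real_inner_smul_left, LinearMap.adjoint_inner_left]
  rcases eq_or_ne μ 0 with rfl | hμ
  · simp
  · field_simp
    ring

/-- Compare `x` with `x + t • (u - x)`: by convexity the subgradient inequality fails by at most `t
* q`, and t → 0. -/
theorem mem_subdifferential_of_mem_solutionMap {Φ : X →ₗ[ℝ] E} {g : X → EReal}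
    (hg : IsProperLscConvex g) {b : E} {μ : ℝ} {x : X}
    (hx : x ∈ solutionMap Φ LinearMap.id g b μ) :
    -((1 / μ) • LinearMap.adjoint Φ (Φ x - b)) ∈ subdifferential g x := by
  obtain ⟨γ, hγ⟩ := exists_eq_coe_of_mem_solutionMap hg hx
  intro u
  set y := -((1 / μ) • LinearMap.adjoint Φ (Φ x - b)) with hy
  rw [hγ]
  induction hgu : g u with
  | bot => exact absurd hgu (hg.ne_bot u)
  | top => simp
  | coe r =>
    norm_cast
    set q := 1 / (2 * μ) * ‖Φ (u - x)‖ ^ 2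
    have hkey : ∀ t ∈ Ioo (0 : ℝ) 1, γ + inner ℝ y (u - x) - r ≤ t * q := by
      rintro t ⟨ht0, ht1⟩
      have hconv := hg.convex_epigraph (show (x, γ) ∈ _ from hγ.le) (show (u, r) ∈ _ from hgu.le)
        (sub_nonneg.2 ht1.le) ht0.le (by ring)
      have hpt : (1 - t) • x + t • u = x + t • (u - x) := by module
      simp only [mem_ofPred_eq, Prod.smul_mk, Prod.mk_add_mk, smul_eq_mul, hpt] at hconv
      have hmin := hx (x + t • (u - x))
      simp only [objective, LinearMap.id_apply, hγ] at hmin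
      have hle := hmin.trans (add_le_add_right hconv _)
      norm_cast at hle
      have hexp := sq_norm_residual Φ b μ x (x + t • (u - x))
      rw [add_sub_cancel_left, map_smul, norm_smul, real_inner_smul_right, ← hy, mul_pow,
        Real.norm_of_nonneg ht0.le] at hexp
      have : t * (γ + inner ℝ y (u - x) - r) ≤ t * (t * q) := by
        simp only [q]
        linarith
      exact le_of_mul_le_mul_left this ht0
    have hlim : Tendsto (fun t : ℝ => t * q) (𝓝[>] 0) (𝓝 0) := by
      have : Tendsto (fun t : ℝ => t * q) (𝓝 0) (𝓝 (0 * q)) := tendsto_id.mul_const q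
      rw [zero_mul] at this
      exact this.mono_left nhdsWithin_le_nhds
    have := ge_of_tendsto hlim (eventually_of_mem (Ioo_mem_nhdsGT one_pos) hkey)
    linarith

theorem mem_solutionMap_of_mem_subdifferential {Φ : X →ₗ[ℝ] E} {g : X → EReal} {b : E} {μ : ℝ}
    (hμ : 0 < μ) {x : X}
    (hx : -((1 / μ) • LinearMap.adjoint Φ (Φ x - b)) ∈ subdifferential g x) :
    x ∈ solutionMap Φ LinearMap.id g b μ := by
  intro u
  have hu := hx u
  set i : ℝ := inner ℝ (-((1 / μ) • LinearMap.adjoint Φ (Φ x - b))) (u - x) with hi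
  have hexp := sq_norm_residual Φ b μ x u
  have hq : 0 ≤ 1 / (2 * μ) * ‖Φ (u - x)‖ ^ 2 := by positivity
  rw [← hi] at hexp
  have hle : 1 / (2 * μ) * ‖Φ x - b‖ ^ 2 - i ≤ 1 / (2 * μ) * ‖Φ u - b‖ ^ 2 := by linarith
  simp only [objective, LinearMap.id_apply]
  refine le_trans (le_of_eq ?_) (add_le_add (EReal.coe_le_coe_iff.2 hle) hu)
  induction g x with
  | bot => simp only [EReal.bot_add, EReal.add_bot]
  | top => simp only [EReal.top_add_coe, EReal.coe_add_top]
  | coe r =>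
    norm_cast
    ring

theorem ker_inter_tangentCone_eq_of_isolatedCalm {Φ : X →ₗ[ℝ] E} {g : X → EReal}
    (hg : IsProperLscConvex g) {b : E} {μ : ℝ} (hμ : 0 < μ) {x : X}
    (hcalm : IsolatedCalm (solutionMap Φ LinearMap.id g) b μ x) :
    (LinearMap.ker Φ : Set X) ∩ tangentCone (subdifferential (conjugate g)
      (-((1 / μ) • LinearMap.adjoint Φ (Φ x - b)))) x = {0} := by
  obtain ⟨hx, κ, hκ, U, hU, V, hV, W, hW, -, hS⟩ := hcalm
  obtain ⟨γ, hγ⟩ := exists_eq_coe_of_mem_solutionMap hg hx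
  have hsub := mem_subdifferential_of_mem_solutionMap hg hx
  refine Subset.antisymm ?_ (singleton_subset_iff.2
    ⟨zero_mem _, zero_mem_tangentCone (mem_subdifferential_conjugate hsub)⟩)
  rintro w ⟨hw, t, z, ht, ht0, hz, hmem⟩
  have hΦz : Tendsto (fun k => Φ (z k)) atTop (𝓝 0) := by
    have := (Φ.continuous_of_finiteDimensional.tendsto w).comp hz
    rwa [LinearMap.mem_ker.1 hw] at this
  have hUk : ∀ᶠ k in atTop, x + t k • z k ∈ U := by
    have : Tendsto (fun k => x + t k • z k) atTop (𝓝 (x + (0 : ℝ) • w)) :=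
      tendsto_const_nhds.add (ht0.smul hz)
    rw [zero_smul, add_zero] at this
    exact this.eventually hU
  have hVk : ∀ᶠ k in atTop, b + t k • Φ (z k) ∈ V := by
    have : Tendsto (fun k => b + t k • Φ (z k)) atTop (𝓝 (b + (0 : ℝ) • (0 : E))) :=
      tendsto_const_nhds.add (ht0.smul hΦz)
    rw [zero_smul, add_zero] at this
    exact this.eventually hV
  have hle : ∀ᶠ k in atTop, ‖z k‖ ≤ κ * ‖Φ (z k)‖ := by
    filter_upwards [hUk, hVk] with k hUk hVk
    have hres : Φ (x + t k • z k) - (b + t k • Φ (z k)) = Φ x - b := by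
      rw [map_add, map_smul]; abel
    have hsol : x + t k • z k ∈ solutionMap Φ LinearMap.id g (b + t k • Φ (z k)) μ := by
      refine mem_solutionMap_of_mem_subdifferential hμ ?_
      rw [hres]
      exact mem_subdifferential_of_mem_subdifferential_conjugate hg hγ hsub (hmem k)
    have := hS _ hVk μ (mem_of_mem_nhds hW) ⟨hsol, hUk⟩
    rw [mem_closedBall_iff_norm, add_sub_cancel_left, add_sub_cancel_left, sub_self, abs_zero,
      add_zero, norm_smul, norm_smul, Real.norm_of_nonneg (ht k).le] at this
    refine le_of_mul_le_mul_left ?_ (ht k)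
    linarith
  have hlim := le_of_tendsto_of_tendsto hz.norm (hΦz.norm.const_mul κ) hle
  rw [norm_zero, mul_zero] at hlim
  exact norm_le_zero_iff.1 hlim

theorem exists_growth_objective {Φ : X →ₗ[ℝ] E} {g : X → EReal}
    (hg : IsProperLscConvex g) {b : E} {μ : ℝ} {x : X}
    (hx : x ∈ solutionMap Φ LinearMap.id g b μ)
    (hgrowth : QuadraticGrowth g x (-((1 / μ) • LinearMap.adjoint Φ (Φ x - b)))) :
    ∃ c > (0 : ℝ), ∃ ε > (0 : ℝ), ∀ u ∈ Metric.ball x ε,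
      objective Φ LinearMap.id g b μ x + ((1 / (2 * μ) * ‖Φ (u - x)‖ ^ 2 + c / 2 * Metric.infDist u
        {v | -((1 / μ) • LinearMap.adjoint Φ (Φ x - b)) ∈ subdifferential g v} ^ 2 : ℝ) : EReal) ≤
      objective Φ LinearMap.id g b μ u := by
  obtain ⟨γ, hγ⟩ := exists_eq_coe_of_mem_solutionMap hg hx
  obtain ⟨c, hc, ε, hε, h⟩ := hgrowth
  refine ⟨c, hc, ε, hε, fun u hu => ?_⟩
  have := h u hu
  simp only [objective, LinearMap.id_apply, hγ] at this ⊢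
  induction hgu : g u with
  | bot => exact absurd hgu (hg.ne_bot u)
  | top =>
    rw [EReal.coe_add_top]
    exact le_top
  | coe r =>
    rw [hgu] at this
    norm_cast at this ⊢
    rw [sq_norm_residual Φ b μ x u]
    linarith

theorem isStrongSolution_of_ker_inter_tangentCone_eq {Φ : X →ₗ[ℝ] E} {g : X → EReal}
    (hg : IsProperLscConvex g) {b : E} {μ : ℝ} (hμ : 0 < μ) {x : X}
    (hx : x ∈ solutionMap Φ LinearMap.id g b μ)
    (hgrowth : QuadraticGrowth g x (-((1 / μ) • LinearMap.adjoint Φ (Φ x - b))))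
    (hker : (LinearMap.ker Φ : Set X) ∩ tangentCone (subdifferential (conjugate g)
      (-((1 / μ) • LinearMap.adjoint Φ (Φ x - b)))) x = {0}) :
    IsStrongSolution (objective Φ LinearMap.id g b μ) x := by
  obtain ⟨γ, hγ⟩ := exists_eq_coe_of_mem_solutionMap hg hx
  have hsub := mem_subdifferential_of_mem_solutionMap hg hx
  obtain ⟨c, hc, ε, hε, hgr⟩ := exists_growth_objective hg hx hgrowth
  set y := -((1 / μ) • LinearMap.adjoint Φ (Φ x - b))
  set S : Set X := {v | y ∈ subdifferential g v}
  have hobj : objective Φ LinearMap.id g b μ x =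
      ((1 / (2 * μ) * ‖Φ x - b‖ ^ 2 + γ : ℝ) : EReal) := by
    simp [objective, hγ]
  refine ⟨by rw [hobj]; exact EReal.coe_ne_top _, ?_⟩
  by_contra! hcon
  have hex : ∀ k : ℕ, ∃ u : X, ‖u - x‖ < ε * (1 / ((k : ℝ) + 1)) ∧
      1 / (2 * μ) * ‖Φ (u - x)‖ ^ 2 + c / 2 * Metric.infDist u S ^ 2 <
        1 / ((k : ℝ) + 1) / 2 * ‖u - x‖ ^ 2 := by
    -- Strong growth is negated with constant 1/(k+1) and radius ε/(k+1), so both shrink while the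
    -- growth bound still applies.
    intro k
    have hk : (0 : ℝ) < 1 / ((k : ℝ) + 1) := Nat.one_div_pos_of_nat
    have hk1 : (1 : ℝ) / ((k : ℝ) + 1) ≤ 1 := by
      rw [div_le_one (by positivity)]
      linarith [Nat.cast_nonneg (α := ℝ) k]
    obtain ⟨u, hu, hlt⟩ := hcon _ hk (ε * (1 / ((k : ℝ) + 1))) (mul_pos hε hk)
    refine ⟨u, mem_ball_iff_norm.1 hu, ?_⟩
    have h := (hgr u (Metric.ball_subset_ball (mul_le_of_le_one_right hε.le hk1) hu)).trans_lt hlt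
    rw [hobj, ← EReal.coe_add, ← EReal.coe_add, EReal.coe_lt_coe_iff] at h
    linarith
  choose u hu hlt using hex
  set t : ℕ → ℝ := fun k => ‖u k - x‖
  have ht : ∀ k, 0 < t k := by
    intro k
    refine (norm_nonneg _).lt_of_ne' fun h0 => ?_
    have h1 := hlt k
    rw [h0] at h1
    have : 0 ≤ 1 / (2 * μ) * ‖Φ (u k - x)‖ ^ 2 + c / 2 * Metric.infDist (u k) S ^ 2 := by
      positivity
    simp at h1
    norm_num at this
    linarith
  have hone := tendsto_one_div_add_atTop_nhds_zero_nat (𝕜 := ℝ)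
  have ht0 : Tendsto t atTop (𝓝 0) := by
    have := hone.const_mul ε
    rw [mul_zero] at this
    exact squeeze_zero (fun k => (ht k).le) (fun k => (hu k).le) this
  set z : ℕ → X := fun k => (t k)⁻¹ • (u k - x)
  have huz : ∀ k, u k - x = t k • z k := fun k => (smul_inv_smul₀ (ht k).ne' _).symm
  have hz : ∀ k, ‖z k‖ = 1 := by
    intro k
    simp only [z, norm_smul, norm_inv, Real.norm_of_nonneg (ht k).le]
    exact inv_mul_cancel₀ (ht k).ne'
  have hlt' : ∀ k, 1 / (2 * μ) * ‖Φ (z k)‖ ^ 2 + c / 2 * (Metric.infDist (u k) S / t k) ^ 2 <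
      1 / ((k : ℝ) + 1) / 2 := by
    intro k
    have h1 := hlt k
    have h2 : ‖Φ (u k - x)‖ = t k * ‖Φ (z k)‖ := by
      rw [huz, map_smul, norm_smul, Real.norm_of_nonneg (ht k).le]
    have h3 : Metric.infDist (u k) S = t k * (Metric.infDist (u k) S / t k) :=
      (mul_div_cancel₀ _ (ht k).ne').symm
    rw [h2, h3] at h1
    refine lt_of_mul_lt_mul_left ?_ (sq_nonneg (t k))
    change _ < _ * t k ^ 2 at h1
    linarith
  have hΦz : Tendsto (fun k => ‖Φ (z k)‖ ^ 2) atTop (𝓝 0) := by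
    have := hone.const_mul μ
    rw [mul_zero] at this
    refine squeeze_zero (fun k => sq_nonneg _) (fun k => ?_) this
    have h1 : 0 ≤ c / 2 * (Metric.infDist (u k) S / t k) ^ 2 := by positivity
    have h2 : 1 / (2 * μ) * ‖Φ (z k)‖ ^ 2 ≤ 1 / ((k : ℝ) + 1) / 2 := by linarith [hlt' k]
    calc ‖Φ (z k)‖ ^ 2 = 2 * μ * (1 / (2 * μ) * ‖Φ (z k)‖ ^ 2) := by field_simp
      _ ≤ 2 * μ * (1 / ((k : ℝ) + 1) / 2) := by gcongr
      _ = μ * (1 / ((k : ℝ) + 1)) := by ring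
  have hdist : Tendsto (fun k => (Metric.infDist (u k) S / t k) ^ 2) atTop (𝓝 0) := by
    have := hone.const_mul (1 / c)
    rw [mul_zero] at this
    refine squeeze_zero (fun k => sq_nonneg _) (fun k => ?_) this
    have h1 : 0 ≤ 1 / (2 * μ) * ‖Φ (z k)‖ ^ 2 := by positivity
    have h2 : c / 2 * (Metric.infDist (u k) S / t k) ^ 2 ≤ 1 / ((k : ℝ) + 1) / 2 := by
      linarith [hlt' k]
    calc (Metric.infDist (u k) S / t k) ^ 2
        = 2 / c * (c / 2 * (Metric.infDist (u k) S / t k) ^ 2) := by field_simp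
      _ ≤ 2 / c * (1 / ((k : ℝ) + 1) / 2) := by gcongr
      _ = 1 / c * (1 / ((k : ℝ) + 1)) := by ring
  have hdist' : Tendsto (fun k => Metric.infDist (u k) S / t k) atTop (𝓝 0) := by
    simpa [Real.sqrt_sq (div_nonneg Metric.infDist_nonneg (ht _).le)] using hdist.sqrt
  obtain ⟨w, hw, θ, hθ, hzw⟩ := (isCompact_sphere (0 : X) 1).tendsto_subseq
    (fun k => mem_sphere_zero_iff_norm.2 (hz k))
  have hwker : Φ w = 0 := by
    have h1 := (((Φ.continuous_of_finiteDimensional.tendsto w).comp hzw).norm.pow 2)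
    have h2 := tendsto_nhds_unique h1 (hΦz.comp hθ.tendsto_atTop)
    simpa using h2
  have hSsub : S ⊆ subdifferential (conjugate g) y := fun v hv => mem_subdifferential_conjugate hv
  have hwtan : w ∈ tangentCone S x := by
    refine mem_tangentCone_of_tendsto_infDist ⟨x, hsub⟩ (fun k => ht (θ k))
      (ht0.comp hθ.tendsto_atTop) hzw ?_
    refine (hdist'.comp hθ.tendsto_atTop).congr fun k => ?_
    simp only [Function.comp_apply]
    rw [← huz, add_sub_cancel]
  have hw0 : w ∈ ({0} : Set X) := by
    rw [← hker]
    obtain ⟨t', z', h1, h2, h3, h4⟩ := hwtan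
    exact ⟨hwker, t', z', h1, h2, h3, fun k => hSsub (h4 k)⟩
  rw [mem_singleton_iff.1 hw0] at hw
  simp at hw

end LeastSquares

theorem isolatedCalm_of_isStrongSolution
    {X E : Type*}
    [NormedAddCommGroup X] [InnerProductSpace ℝ X] [FiniteDimensional ℝ X]
    [NormedAddCommGroup E] [InnerProductSpace ℝ E]
    {Φ : X →ₗ[ℝ] E} {g : X → EReal}
    (hg : IsProperLscConvex g) {b₀ : E} {μ₀ : ℝ} (hμ₀ : 0 < μ₀) {x₀ : X}
    (hx₀ : x₀ ∈ solutionMap Φ LinearMap.id g b₀ μ₀)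
    (hstrong : IsStrongSolution (objective Φ LinearMap.id g b₀ μ₀) x₀) :
    IsolatedCalm (solutionMap Φ LinearMap.id g) b₀ μ₀ x₀ := by
  obtain ⟨γ, hγ⟩ := exists_eq_coe_of_mem_solutionMap hg hx₀
  obtain ⟨-, c, hc, ε, hε, hgr⟩ := hstrong
  obtain ⟨L, hL, hΦ⟩ := (LinearMap.toContinuousLinearMap Φ).bound
  simp only [LinearMap.coe_toContinuousLinearMap'] at hΦ
  set M : ℝ := 2 * ‖Φ x₀ - b₀‖ + L * ε with hM
  have hM0 : 0 ≤ M := by positivity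
  set A : ℝ := 4 / μ₀ + 2 * M / μ₀ ^ 2 with hA
  have hA0 : 0 < A := by positivity
  -- `b` needs no localization; μ > μ₀/2 is what bounds 1/μ by 2/μ₀.
  refine ⟨hx₀, L * A / c, by positivity, Metric.ball x₀ ε, Metric.ball_mem_nhds _ hε, univ,
    univ_mem, Ioi (μ₀ / 2), Ioi_mem_nhds (by linarith), fun μ hμ => ?_, ?_⟩
  · rw [mem_Ioi] at hμ ⊢
    linarith
  rintro b - μ hμ x ⟨hx, hxball⟩
  rw [mem_Ioi] at hμ
  have hμ0 : 0 < μ := by linarith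
  obtain ⟨r, hr⟩ := exists_eq_coe_of_mem_solutionMap hg hx
  have h1 := hgr x hxball
  have h2 := hx x₀
  simp only [objective, LinearMap.id_apply, hγ, hr] at h1 h2
  norm_cast at h1 h2
  rw [mem_closedBall_iff_norm]
  rw [mem_ball_iff_norm] at hxball
  set n := ‖x - x₀‖
  set s := Φ x₀ + Φ x
  set d := (1 / μ) • (s - (2 : ℝ) • b) - (1 / μ₀) • (s - (2 : ℝ) • b₀) with hd
  -- Sum of `h1` and `h2`, with differences of squares factored; `d` vanishes when (b, μ) = (b₀,
  -- μ₀).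
  have hinner : c * n ^ 2 ≤ inner ℝ (Φ x₀ - Φ x) d := by
    have e1 := sq_norm_sub_sub_sq_norm_sub (Φ x₀) (Φ x) b
    have e2 := sq_norm_sub_sub_sq_norm_sub (Φ x₀) (Φ x) b₀
    rw [hd, inner_sub_right, real_inner_smul_right, real_inner_smul_right, ← e1, ← e2]
    have f1 : 1 / (2 * μ) = 1 / μ / 2 := by field_simp
    have f2 : 1 / (2 * μ₀) = 1 / μ₀ / 2 := by field_simp
    rw [f2] at h1
    rw [f1] at h2
    linarith
  have hsub : ‖Φ x₀ - Φ x‖ ≤ L * n := by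
    rw [← map_sub, ← norm_neg, ← map_neg, neg_sub]
    exact hΦ _
  have hs : ‖s - (2 : ℝ) • b₀‖ ≤ M := by
    have e : s - (2 : ℝ) • b₀ = (2 : ℝ) • (Φ x₀ - b₀) - (Φ x₀ - Φ x) := by
      simp only [s]; module
    have hn : L * n ≤ L * ε := by gcongr
    rw [e]
    refine (norm_sub_le _ _).trans ?_
    rw [norm_smul, Real.norm_of_nonneg zero_le_two]
    linarith
  have hinv : 1 / μ ≤ 2 / μ₀ := by
    rw [div_le_div_iff₀ hμ0 hμ₀]
    linarith
  have hdle : ‖d‖ ≤ A * (‖b - b₀‖ + |μ - μ₀|) := by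
    have e : d = -((1 / μ * 2) • (b - b₀)) - ((1 / μ) * (1 / μ₀) * (μ - μ₀)) •
        (s - (2 : ℝ) • b₀) := by
      have e' : (1 / μ) * (1 / μ₀) * (μ - μ₀) = 1 / μ₀ - 1 / μ := by field_simp
      rw [e', hd]
      module
    have p1 : 1 / μ * 2 * ‖b - b₀‖ ≤ 4 / μ₀ * ‖b - b₀‖ := by
      have : 4 / μ₀ = 2 / μ₀ * 2 := by ring
      rw [this]
      gcongr
    have p2 : (1 / μ) * (1 / μ₀) * |μ - μ₀| * ‖s - (2 : ℝ) • b₀‖ ≤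
        2 * M / μ₀ ^ 2 * |μ - μ₀| := by
      have : 2 * M / μ₀ ^ 2 * |μ - μ₀| = 2 / μ₀ * (1 / μ₀) * |μ - μ₀| * M := by
        field_simp
      rw [this]
      gcongr
    have p3 : 0 ≤ 4 / μ₀ * |μ - μ₀| := by positivity
    have p4 : 0 ≤ 2 * M / μ₀ ^ 2 * ‖b - b₀‖ := by positivity
    rw [e]
    refine (norm_sub_le _ _).trans ?_
    rw [norm_neg, norm_smul, norm_smul, norm_mul, norm_mul, norm_mul, Real.norm_eq_abs (μ - μ₀),
      Real.norm_of_nonneg (by positivity : 0 ≤ 1 / μ),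
      Real.norm_of_nonneg (by positivity : 0 ≤ 1 / μ₀), Real.norm_of_nonneg zero_le_two, hA]
    linarith
  have hfin : c * n ^ 2 ≤ L * n * (A * (‖b - b₀‖ + |μ - μ₀|)) :=
    hinner.trans ((real_inner_le_norm _ _).trans
      (mul_le_mul hsub hdle (norm_nonneg _) (by positivity)))
  rw [div_mul_eq_mul_div, le_div_iff₀ hc]
  rcases (norm_nonneg (x - x₀)).eq_or_lt with h0 | h0
  · change 0 = n at h0
    rw [← h0, zero_mul]
    positivity
  · refine le_of_mul_le_mul_left ?_ h0
    change n * (n * c) ≤ n * _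
    linarith

end IsolatedCalmness

theorem corollary4p4
    {X E : Type*}
    [NormedAddCommGroup X] [InnerProductSpace ℝ X] [FiniteDimensional ℝ X]
    [NormedAddCommGroup E] [InnerProductSpace ℝ E] [FiniteDimensional ℝ E]
    (Φ : X →ₗ[ℝ] E) (K : X →ₗ[ℝ] X) (hK : K = LinearMap.id)
    (g : X → EReal) (hg : IsolatedCalmness.IsProperLscConvex g)
    (b₀ : E) (μ₀ : ℝ) (hμ₀ : 0 < μ₀)
    (x₀ : X) (hx₀ : x₀ ∈ IsolatedCalmness.solutionMap Φ K g b₀ μ₀)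
    (y₀ : X) (hy₀ : y₀ = -((1 / μ₀) • LinearMap.adjoint Φ (Φ x₀ - b₀)))
    (hgrowth : IsolatedCalmness.QuadraticGrowth g x₀ y₀) :
    List.TFAE [
      IsolatedCalmness.IsolatedCalm (IsolatedCalmness.solutionMap Φ K g) b₀ μ₀ x₀,
      IsolatedCalmness.IsStrongSolution (IsolatedCalmness.objective Φ K g b₀ μ₀) x₀,
      (LinearMap.ker Φ : Set X) ∩ IsolatedCalmness.tangentCone
        (IsolatedCalmness.subdifferential (IsolatedCalmness.conjugate g) y₀) x₀ = {0}] := by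
  subst hK hy₀
  tfae_have 1 → 3 := IsolatedCalmness.ker_inter_tangentCone_eq_of_isolatedCalm hg hμ₀
  tfae_have 3 → 2 :=
    IsolatedCalmness.isStrongSolution_of_ker_inter_tangentCone_eq hg hμ₀ hx₀ hgrowth
  tfae_have 2 → 1 := IsolatedCalmness.isolatedCalm_of_isStrongSolution hg hμ₀ hx₀
  tfae_finish
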